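/- Let $d\ge 1$, $m>0$ and $0\le\omega\le 2$, and put $t=\omega/(m^2+2d)$; then $t<1/d$. For $L\ge1$ let $\mathbb Z_L^d$ be the periodic lattice with coordinates labelled $1,\dots,L$, and for a site $z$ let $M_z$ be the $L^d\times L^d$ matrix of the overrelaxation update of the single site $z$, $$(M_z)_{x,y}=\delta_{x,y}+\delta_{x,z}\Bigl[-\omega\,\delta_{x,y}+t\sum_{\mu=1}^d\bigl(\delta_{x+e_\mu,y}+\delta_{x-e_\mu,y}\bigr)\Bigr].$$ A lexicographic sweep is an enumeration $x_1,\dots,x_{L^d}$ of the sites in which $x-e_\mu$ precedes $x$ whenever $x_\mu\ne1$ (for instance the lexicographic order). Its update matrix is $M=M_{x_{L^d}}\cdots M_{x_2}M_{x_1}$, and its matrix in momentum space is $$M_{p,q}=L^{-d}\sum_{x,y\in\mathbb Z_L^d}e^{-2\pi i p\cdot x/L}\,M_{x,y}\,e^{2\pi i q\cdot y/L},\qquad p,q\in\mathbb Z_L^d .$$ There is a constant $C$, depending only on $d,m,\omega$, such that for every $L\ge 1$ and every lexicographic sweep there are matrices $G^{(0)},\dots,G^{(d)}$ and $E$ (which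 may depend on $L$) with $$M=\sum_{l=0}^{d}\frac1{L^l}\,G^{(l)}+E,\qquad |E_{p,q}|\le \frac CL\,t^L\quad\text{for all }p,q,$$ where $$G^{(l)}_{p,q}=\sum_{\alpha\subseteq\{1,\dots,d\},\ \#\alpha=l}\ \Bigl(\prod_{\nu\notin\alpha}\delta_{p_\nu,q_\nu}\Bigr)\hat G^{\alpha}_{p,q},\qquad |\hat G^\alpha_{p,q}|\le C,\quad |G^{(l)}_{p,q}|\le C\quad\text{for all }p,q .$$ The leading term is the diagonal matrix $$G^{(0)}_{p,q}=M^D_{p,q}=\bigl[(1-N^D)^{-1}O^D\bigr]_{p,q}=\delta_{p,q}\,\frac{1-\omega+t\sum_{\mu=1}^d e^{2\pi i p_\mu/L}}{1-t\sum_{\mu=1}^d e^{-2\pi i p_\mu/L}},$$ where $O^D_{p,q}=\delta_{p,q}\bigl(1-\omega+t\sum_\mu e^{2\pi i q_\mu/L}\bigr)$ and $N^D_{p,q}=\delta_{p,q}\,t\sum_\mu e^{-2\pi i q_\mu/L}$. -/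

import Mathlib

open scoped BigOperators

namespace LexUpdate

/-- The periodic lattice `ℤ_L^d`. It is also used as the set of lattice momenta. In every
direction the coordinates are labelled `1, 2, …, L`, where the label `L` is `0 : ZMod L`. -/
abbrev Site (d L : ℕ) : Type := Fin d → ZMod L

/-- The unit vector `e_μ`. -/
def unitVec {d L : ℕ} (μ : Fin d) : Site d L := Pi.single μ 1

/-- The squared frequency `m² + 2d` of a single site. -/
def siteFreqSq (d : ℕ) (m : ℝ) : ℝ := m ^ 2 + 2 * d

/-- The ratio `ω / (m² + 2d)` of the overrelaxation parameter and the squared frequency. -/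
noncomputable def hop (d : ℕ) (m ω : ℝ) : ℝ := ω / siteFreqSq d m

/-- The matrix of the overrelaxation update of the single site `z`. It is the part linear in the
field of `φ'_z = (1 - ω) φ_z + ω / (m² + 2d) * ∑_μ (φ_{z+e_μ} + φ_{z-e_μ}) + noise`. -/
noncomputable def siteUpdate {d L : ℕ} (m ω : ℝ) (z : Site d L) :
    Matrix (Site d L) (Site d L) ℝ :=
  fun x y => (if x = y then 1 else 0) + (if x = z then 1 else 0) *
    (-ω * (if x = y then 1 else 0) + hop d m ω *
      ∑ μ : Fin d, ((if x + unitVec μ = y then 1 else 0) + (if x - unitVec μ = y then 1 else 0)))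

/-- A lexicographic sweep lists every site exactly once, and updates `x - e_μ` before `x`
except across the boundary of the lattice (that is, except when `x_μ = 1`). -/
structure IsLexSweep {d L : ℕ} (s : List (Site d L)) : Prop where
  nodup : s.Nodup
  complete : ∀ x, x ∈ s
  before : ∀ (x : Site d L) (μ : Fin d), x μ ≠ 1 → s.idxOf (x - unitVec μ) < s.idxOf x

/-- The update matrix `M_{x_n} ⋯ M_{x_2} M_{x_1}` of a sweep that visits the sites
`x_1, x_2, …, x_n` in this order. -/
noncomputable def sweepUpdate {d L : ℕ} [NeZero L] (m ω : ℝ) (s : List (Site d L)) :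
    Matrix (Site d L) (Site d L) ℝ :=
  (s.map (siteUpdate m ω)).reverse.prod

/-- The phase `exp (2 π i k / L)` of `k : ZMod L`. -/
noncomputable def phase {L : ℕ} [NeZero L] (k : ZMod L) : ℂ := ZMod.stdAddChar k

/-- The matrix of an operator in momentum space, with respect to the Fourier transform
`φ_x = L ^ (-d/2) * ∑_p φ_p exp (2 π i p·x / L)`. -/
noncomputable def momentumMatrix {d L : ℕ} [NeZero L] (A : Matrix (Site d L) (Site d L) ℝ) :
    Matrix (Site d L) (Site d L) ℂ :=
  fun p q => (1 / (L : ℂ) ^ d) *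
    ∑ x : Site d L, ∑ y : Site d L, phase (-(p ⬝ᵥ x)) * (A x y : ℂ) * phase (q ⬝ᵥ y)

/-- The translation invariant part of the dependence of a lexicographic sweep on the old
variables, in momentum space. -/
noncomputable def oldDiag (d L : ℕ) [NeZero L] (m ω : ℝ) : Matrix (Site d L) (Site d L) ℂ :=
  Matrix.diagonal fun q => 1 - (ω : ℂ) + (hop d m ω : ℂ) * ∑ μ : Fin d, phase (q μ)

/-- The translation invariant part of the dependence of a lexicographic sweep on the new
variables, in momentum space. -/
noncomputable def newDiag (d L : ℕ) [NeZero L] (m ω : ℝ) : Matrix (Site d L) (Site d L) ℂ :=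
  Matrix.diagonal fun q => (hop d m ω : ℂ) * ∑ μ : Fin d, phase (-(q μ))

/-- The leading matrix `M^D`. -/
noncomputable def leadingDiag (d L : ℕ) [NeZero L] (m ω : ℝ) :
    Matrix (Site d L) (Site d L) ℂ :=
  Matrix.diagonal fun p =>
    (1 - (ω : ℂ) + (hop d m ω : ℂ) * ∑ μ : Fin d, phase (p μ)) /
      (1 - (hop d m ω : ℂ) * ∑ μ : Fin d, phase (-(p μ)))

/-- The modified Kronecker delta `∏_{ν ∉ α} δ_{p_ν, q_ν}`. -/
def partialDelta {d L : ℕ} (α : Finset (Fin d)) (p q : Site d L) : ℂ :=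
  ∏ ν ∈ αᶜ, if p ν = q ν then 1 else 0

end LexUpdate

namespace LexUpdate

open Finset

/-! ### Phases and orthogonality of characters -/

section Phase

variable {L : ℕ} [NeZero L]

/-! A site changes only at its own update, so M - 1 = I + N (M - 1), where I is the increment and N
its part from neighbours already updated (`sweepUpdate_sub_one`). N strictly lowers the position in
the sweep, so it is nilpotent and M = 1 + (∑ N^k) I (`sweepUpdate_eq`). I is translation invariant
and acts in momentum space as the factor `symbol`; the boundary effects all sit in N.

For a lexicographic sweep, N is t times a sum over directions of copies of `earlier L`
(`newPart_eq`), so N^k is t^k times a sum of d^k tensor products of powers. In one dimension,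
`earlier L ^ n` differs from the periodic shift power by entries of total size at most 2n, uniformly
in L (`entrySum_earlier_pow_sub`). In momentum space each direction is therefore a delta times a
phase plus O(n/L). Expanding the product over directions, with α the set where the correction is
chosen, yields the modified deltas and the powers of 1/L (`exists_isExpansion_tensor`).

The coefficients of N^k are at most (td)^k (2(k+1))^d, summable because td < 1. Summing them over
all k, beyond the nilpotency index too, turns the α = ∅ term into the full geometric series and
leaves no remainder (`exists_isExpansion_resolvent`). -/

lemma phase_zero : phase (0 : ZMod L) = 1 := by
  simp [phase]

lemma phase_add (a b : ZMod L) : phase (a + b) = phase a * phase b :=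
  AddChar.map_add_eq_mul _ _ _

lemma norm_phase (a : ZMod L) : ‖phase a‖ = 1 := by
  simp [phase]

lemma phase_sum {ι : Type*} (s : Finset ι) (f : ι → ZMod L) :
    phase (∑ i ∈ s, f i) = ∏ i ∈ s, phase (f i) := by
  classical
  induction s using Finset.induction_on with
  | empty => simp [phase_zero]
  | insert a s ha ih => rw [sum_insert ha, prod_insert ha, phase_add, ih]

lemma sum_phase_mul (k : ZMod L) :
    ∑ x : ZMod L, phase (x * k) = if k = 0 then (L : ℂ) else 0 := by
  have := AddChar.sum_mulShift k (ZMod.isPrimitive_stdAddChar L)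
  simpa [phase, ZMod.card] using this

end Phase

/-! ### One-dimensional shifts and their boundary corrections -/

section OneDim

variable {L : ℕ} [NeZero L]

/-- The matrix in momentum space of a matrix on a one-dimensional lattice. -/
noncomputable def momentumMatrix₁ (T : Matrix (ZMod L) (ZMod L) ℝ) : Matrix (ZMod L) (ZMod L) ℂ :=
  fun p q => (1 / (L : ℂ)) * ∑ x, ∑ y, phase (-(p * x)) * (T x y : ℂ) * phase (q * y)

/-- The sum of the absolute values of the entries of a matrix. -/
def entrySum (T : Matrix (ZMod L) (ZMod L) ℝ) : ℝ := ∑ x, ∑ y, |T x y|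

lemma momentumMatrix₁_add (S T : Matrix (ZMod L) (ZMod L) ℝ) (p q : ZMod L) :
    momentumMatrix₁ (S + T) p q = momentumMatrix₁ S p q + momentumMatrix₁ T p q := by
  simp only [momentumMatrix₁, Matrix.add_apply, Complex.ofReal_add, mul_add, add_mul,
    sum_add_distrib]

lemma norm_momentumMatrix₁_le (T : Matrix (ZMod L) (ZMod L) ℝ) (p q : ZMod L) :
    ‖momentumMatrix₁ T p q‖ ≤ 1 / L * entrySum T := by
  rw [momentumMatrix₁, norm_mul, norm_div, norm_one, Complex.norm_natCast, entrySum]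
  gcongr
  refine (norm_sum_le _ _).trans (sum_le_sum fun x _ => (norm_sum_le _ _).trans
    (sum_le_sum fun y _ => ?_))
  simp [norm_phase]

lemma momentumMatrix₁_one (p q : ZMod L) :
    momentumMatrix₁ (1 : Matrix (ZMod L) (ZMod L) ℝ) p q = if p = q then 1 else 0 := by
  have hL : (L : ℂ) ≠ 0 := Nat.cast_ne_zero.mpr (NeZero.ne L)
  have h : ∀ x : ZMod L, ∑ y, phase (-(p * x)) * (((1 : Matrix (ZMod L) (ZMod L) ℝ) x y : ℝ) : ℂ) *
      phase (q * y) = phase (x * (q - p)) := by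
    intro x
    rw [sum_eq_single x]
    · rw [Matrix.one_apply_eq, Complex.ofReal_one, mul_one, ← phase_add]
      congr 1
      ring
    · intro y _ hy
      simp [Matrix.one_apply_ne hy.symm]
    · simp
  simp only [momentumMatrix₁, h, sum_phase_mul, sub_eq_zero, eq_comm (a := q)]
  split_ifs
  · field_simp
  · simp

/-- The backward shift, with periodic boundary conditions. -/
def shiftBack (L : ℕ) : Matrix (ZMod L) (ZMod L) ℝ := fun x y => if x - 1 = y then 1 else 0

/-- The backward shift, with free boundary conditions. -/
def freeShift (L : ℕ) : Matrix (ZMod L) (ZMod L) ℝ :=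
  fun x y => if x ≠ 1 ∧ x - 1 = y then 1 else 0

/-- The matrix of the link that leads from the last site to the first one. -/
def wrapLink (L : ℕ) : Matrix (ZMod L) (ZMod L) ℝ :=
  fun x y => if (x = 0 ∧ x ≠ 1) ∧ x + 1 = y then 1 else 0

/-- The dependence of a site on its neighbours that are updated earlier. -/
def earlier (L : ℕ) : Matrix (ZMod L) (ZMod L) ℝ := freeShift L + wrapLink L

lemma shiftBack_mul (T : Matrix (ZMod L) (ZMod L) ℝ) (x y : ZMod L) :
    (shiftBack L * T) x y = T (x - 1) y := by
  simp [Matrix.mul_apply, shiftBack]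

lemma mul_shiftBack (T : Matrix (ZMod L) (ZMod L) ℝ) (x y : ZMod L) :
    (T * shiftBack L) x y = T x (y + 1) := by
  simp [Matrix.mul_apply, shiftBack, sub_eq_iff_eq_add]

lemma freeShift_mul (T : Matrix (ZMod L) (ZMod L) ℝ) (x y : ZMod L) :
    (freeShift L * T) x y = if x ≠ 1 then T (x - 1) y else 0 := by
  by_cases h : x = 1 <;> simp [Matrix.mul_apply, freeShift, h]

lemma wrapLink_mul (T : Matrix (ZMod L) (ZMod L) ℝ) (x y : ZMod L) :
    (wrapLink L * T) x y = if x = 0 ∧ x ≠ 1 then T (x + 1) y else 0 := by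
  by_cases h : x = 0 ∧ x ≠ 1
  · rw [if_pos h, Matrix.mul_apply, sum_eq_single (x + 1)]
    · rw [wrapLink, if_pos ⟨h, rfl⟩, one_mul]
    · intro w _ hw
      rw [wrapLink, if_neg fun h' => hw h'.2.symm, zero_mul]
    · simp
  · rw [if_neg h, Matrix.mul_apply]
    exact sum_eq_zero fun w _ => by rw [wrapLink, if_neg fun h' => h h'.1, zero_mul]

lemma momentumMatrix₁_shiftBack_mul (T : Matrix (ZMod L) (ZMod L) ℝ) (p q : ZMod L) :
    momentumMatrix₁ (shiftBack L * T) p q = phase (-p) * momentumMatrix₁ T p q := by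
  have h : ∑ x, ∑ y, phase (-(p * x)) * ((shiftBack L * T) x y : ℂ) * phase (q * y) =
      phase (-p) * ∑ x, ∑ y, phase (-(p * x)) * (T x y : ℂ) * phase (q * y) := by
    rw [mul_sum, ← Equiv.sum_comp (Equiv.addRight (1 : ZMod L))]
    refine sum_congr rfl fun x _ => ?_
    rw [mul_sum]
    refine sum_congr rfl fun y _ => ?_
    rw [shiftBack_mul, Equiv.coe_addRight, add_sub_cancel_right,
      show -(p * (x + 1)) = -p + -(p * x) by ring, phase_add]
    ring
  rw [momentumMatrix₁, momentumMatrix₁, h]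
  ring

lemma momentumMatrix₁_shiftBack_pow (n : ℕ) (p q : ZMod L) :
    momentumMatrix₁ (shiftBack L ^ n) p q = (if p = q then 1 else 0) * phase (-p) ^ n := by
  induction n with
  | zero => simp [momentumMatrix₁_one]
  | succ n ih => rw [pow_succ', momentumMatrix₁_shiftBack_mul, ih]; ring

lemma entrySum_add_le (S T : Matrix (ZMod L) (ZMod L) ℝ) :
    entrySum (S + T) ≤ entrySum S + entrySum T := by
  simp only [entrySum, ← sum_add_distrib]
  gcongr with x _ y _
  exact abs_add_le _ _

lemma entrySum_mul_shiftBack (T : Matrix (ZMod L) (ZMod L) ℝ) :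
    entrySum (T * shiftBack L) = entrySum T := by
  simp only [entrySum, mul_shiftBack]
  exact sum_congr rfl fun x _ => Equiv.sum_comp (Equiv.addRight (1 : ZMod L)) fun y => |T x y|

lemma entrySum_mul_shiftBack_pow (T : Matrix (ZMod L) (ZMod L) ℝ) (n : ℕ) :
    entrySum (T * shiftBack L ^ n) = entrySum T := by
  induction n with
  | zero => simp
  | succ n ih => rw [pow_succ, ← mul_assoc, entrySum_mul_shiftBack, ih]

lemma entrySum_freeShift_mul_le (T : Matrix (ZMod L) (ZMod L) ℝ) :
    entrySum (freeShift L * T) ≤ entrySum T := by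
  rw [entrySum, entrySum, ← Equiv.sum_comp (Equiv.subRight (1 : ZMod L)) fun x => ∑ y, |T x y|]
  refine sum_le_sum fun x _ => sum_le_sum fun y _ => ?_
  rw [freeShift_mul, Equiv.subRight_apply]
  split_ifs <;> simp

lemma entrySum_freeShift_sub : entrySum (freeShift L - shiftBack L) ≤ 1 := by
  have h : ∀ x y : ZMod L, |(freeShift L - shiftBack L) x y| =
      if x = 1 then (if x - 1 = y then 1 else 0) else 0 := by
    intro x y
    by_cases hx : x = 1 <;> by_cases hy : x - 1 = y <;> simp [freeShift, shiftBack, hx, hy]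
    · subst hx; simp at hy; simp [hy]
    · subst hx; simp at hy; simp [hy]
  simp only [entrySum, h]
  simp

lemma entrySum_wrapLink : entrySum (wrapLink L) ≤ 1 := by
  have h : ∀ x y : ZMod L, |wrapLink L x y| ≤ if x = 0 then (if x + 1 = y then 1 else 0) else 0 := by
    intro x y
    by_cases hx : x = 0 <;> by_cases hy : x + 1 = y <;> by_cases h1 : x = 1 <;>
      simp [wrapLink, hx, hy, h1] <;> split_ifs <;> simp_all
  calc entrySum (wrapLink L) ≤ ∑ x : ZMod L, ∑ y, if x = 0 then (if x + 1 = y then 1 else 0) else 0 :=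
        sum_le_sum fun x _ => sum_le_sum fun y _ => h x y
    _ = 1 := by simp

/-- The wrap link ends at label 1, where the free shift has a zero row. -/
lemma earlier_mul_freeShift : earlier L * freeShift L = freeShift L * freeShift L := by
  rw [earlier, add_mul, add_eq_left]
  ext x y
  rw [wrapLink_mul]
  split_ifs with h
  · simp [freeShift, h.1]
  · rfl

/-- The wrap link starts at label L. A free step could arrive there only from label 1, across the
boundary, and a wrap link arrives at label 1. -/
lemma earlier_mul_wrapLink : earlier L * wrapLink L = 0 := by
  ext x y
  rw [earlier, add_mul, Matrix.add_apply, wrapLink_mul, freeShift_mul]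
  have h₁ : x ≠ 1 → wrapLink L (x - 1) y = 0 := by
    intro h
    simp [wrapLink, sub_eq_zero, h]
  have h₂ : x = 0 ∧ x ≠ 1 → wrapLink L (x + 1) y = 0 := by
    rintro ⟨rfl, -⟩
    simp [wrapLink]
  split_ifs <;> simp_all

lemma earlier_pow_add_two (n : ℕ) : earlier L ^ (n + 2) = freeShift L ^ (n + 2) := by
  induction n with
  | zero =>
    have h : earlier L * earlier L = earlier L * freeShift L + earlier L * wrapLink L :=
      mul_add _ _ _
    rw [zero_add, pow_two, pow_two, h, earlier_mul_freeShift, earlier_mul_wrapLink, add_zero]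
  | succ n ih =>
    rw [show n + 1 + 2 = (n + 2) + 1 by ring, pow_succ' (earlier L), ih, pow_succ' (freeShift L) (n + 1),
      ← mul_assoc, earlier_mul_freeShift]
    simp only [pow_succ', mul_assoc]

/-- Telescoping: each of the n exchanges of a free for a periodic shift costs one boundary entry,
since the free shift does not increase `entrySum` and the periodic one preserves it. -/
lemma entrySum_freeShift_pow_sub (n : ℕ) : entrySum (freeShift L ^ n - shiftBack L ^ n) ≤ n := by
  induction n with
  | zero => simp [entrySum]
  | succ n ih =>
    have h : freeShift L ^ (n + 1) - shiftBack L ^ (n + 1) =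
        freeShift L * (freeShift L ^ n - shiftBack L ^ n) +
          (freeShift L - shiftBack L) * shiftBack L ^ n := by
      simp only [pow_succ']
      noncomm_ring
    rw [h]
    refine (entrySum_add_le _ _).trans ?_
    rw [entrySum_mul_shiftBack_pow]
    push_cast
    exact add_le_add ((entrySum_freeShift_mul_le _).trans ih) entrySum_freeShift_sub

/-- The wrap link survives only for n = 1, where it adds one more unit; this is the origin of the
factor 2. -/
lemma entrySum_earlier_pow_sub (n : ℕ) :
    entrySum (earlier L ^ n - shiftBack L ^ n) ≤ 2 * n := by
  match n with
  | 0 => simp [entrySum]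
  | 1 =>
    have h : earlier L ^ 1 - shiftBack L ^ 1 = (freeShift L - shiftBack L) + wrapLink L := by
      rw [earlier, pow_one, pow_one]
      abel
    rw [h]
    refine (entrySum_add_le _ _).trans ?_
    have := entrySum_freeShift_sub (L := L)
    have := entrySum_wrapLink (L := L)
    push_cast
    linarith
  | n + 2 =>
    rw [earlier_pow_add_two]
    refine (entrySum_freeShift_pow_sub _).trans ?_
    push_cast
    linarith [n.cast_nonneg (α := ℝ)]

end OneDim

/-! ### The sweep as a resolvent of a nilpotent matrix -/

section Sweep

variable {d L : ℕ} [NeZero L] {m ω : ℝ}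

/-- The change of the field at a site in an overrelaxation update of that site. -/
noncomputable def increment (d L : ℕ) (m ω : ℝ) : Matrix (Site d L) (Site d L) ℝ :=
  fun x y => -ω * (if x = y then 1 else 0) + hop d m ω *
      ∑ μ : Fin d, ((if x + unitVec μ = y then 1 else 0) + (if x - unitVec μ = y then 1 else 0))

lemma siteUpdate_mul (z : Site d L) (A : Matrix (Site d L) (Site d L) ℝ) (x y : Site d L) :
    (siteUpdate m ω z * A) x y =
      A x y + (if x = z then 1 else 0) * (increment d L m ω * A) x y := by
  have h : ∀ w, siteUpdate m ω z x w =
      (1 : Matrix (Site d L) (Site d L) ℝ) x w + (if x = z then 1 else 0) * increment d L m ω x w :=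
    fun w => rfl
  simp only [Matrix.mul_apply, h, add_mul, sum_add_distrib, mul_assoc, mul_sum]
  rw [← Matrix.mul_apply, one_mul]

lemma sweepUpdate_append (l₁ l₂ : List (Site d L)) :
    sweepUpdate m ω (l₁ ++ l₂) = sweepUpdate m ω l₂ * sweepUpdate m ω l₁ := by
  simp [sweepUpdate]

lemma sweepUpdate_cons (z : Site d L) (l : List (Site d L)) :
    sweepUpdate m ω (z :: l) = sweepUpdate m ω l * siteUpdate m ω z := by
  simp [sweepUpdate]

lemma sweepUpdate_mul_of_notMem {l : List (Site d L)} {x : Site d L} (hx : x ∉ l)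
    (A : Matrix (Site d L) (Site d L) ℝ) (y : Site d L) :
    (sweepUpdate m ω l * A) x y = A x y := by
  induction l generalizing A with
  | nil => simp [sweepUpdate]
  | cons z l ih =>
    rw [List.mem_cons, not_or] at hx
    rw [sweepUpdate_cons, mul_assoc, ih hx.2, siteUpdate_mul, if_neg hx.1, zero_mul, add_zero]

/-- The part of the increment that depends on the sites that precede `x` in the sweep. -/
noncomputable def newPart (m ω : ℝ) (s : List (Site d L)) : Matrix (Site d L) (Site d L) ℝ :=
  fun x y => if s.idxOf y < s.idxOf x then increment d L m ω x y else 0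

lemma sweepUpdate_sub_one {s : List (Site d L)} (hs : s.Nodup) (hc : ∀ x, x ∈ s) :
    sweepUpdate m ω s - 1 =
      increment d L m ω + newPart m ω s * (sweepUpdate m ω s - 1) := by
  ext z y
  obtain ⟨l₁, l₂, rfl⟩ := List.append_of_mem (hc z)
  have hs' := List.nodup_append.mp hs
  have hz₁ : z ∉ l₁ := fun h => hs'.2.2 z h z (by simp) rfl
  have hz₂ : z ∉ l₂ := (List.nodup_cons.mp hs'.2.1).1
  have hidx : ∀ w, (l₁ ++ z :: l₂).idxOf w < (l₁ ++ z :: l₂).idxOf z ↔ w ∈ l₁ := by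
    intro w
    rw [List.idxOf_append_of_notMem hz₁, List.idxOf_cons_self, add_zero]
    by_cases hw : w ∈ l₁
    · simp [hw, List.idxOf_append_of_mem hw, List.idxOf_lt_length_of_mem hw]
    · simp [hw, List.idxOf_append_of_notMem hw]
  -- When `z` is updated, rows in `l₁` already have their final values and all other rows are still
  -- those of the identity.
  have hpre : ∀ w, (sweepUpdate m ω l₁ - 1) w y =
      if w ∈ l₁ then (sweepUpdate m ω (l₁ ++ z :: l₂) - 1) w y else 0 := by
    intro w
    split_ifs with hw
    · rw [sweepUpdate_append, Matrix.sub_apply, Matrix.sub_apply, sweepUpdate_mul_of_notMem]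
      exact fun h => hs'.2.2 w hw w h rfl
    · rw [Matrix.sub_apply, ← mul_one (sweepUpdate m ω l₁), sweepUpdate_mul_of_notMem hw, sub_self]
  have hz : sweepUpdate m ω (l₁ ++ z :: l₂) z y =
      sweepUpdate m ω l₁ z y + (increment d L m ω * sweepUpdate m ω l₁) z y := by
    rw [sweepUpdate_append, sweepUpdate_cons, mul_assoc, sweepUpdate_mul_of_notMem hz₂,
      siteUpdate_mul, if_pos rfl, one_mul]
  have hz' : sweepUpdate m ω l₁ z y = (1 : Matrix (Site d L) (Site d L) ℝ) z y := by
    rw [← mul_one (sweepUpdate m ω l₁), sweepUpdate_mul_of_notMem hz₁]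
  have hsplit : increment d L m ω * sweepUpdate m ω l₁ =
      increment d L m ω + increment d L m ω * (sweepUpdate m ω l₁ - 1) := by
    noncomm_ring
  rw [Matrix.sub_apply, hz, hz', hsplit, Matrix.add_apply, add_sub_cancel_left, Matrix.add_apply,
    Matrix.mul_apply, Matrix.mul_apply]
  congr 1
  refine sum_congr rfl fun w _ => ?_
  simp only [hpre, newPart, hidx]
  split_ifs <;> simp

/-- Each factor lowers the position in the sweep by at least one. -/
lemma newPart_pow_apply_eq_zero (s : List (Site d L)) (k : ℕ) {x y : Site d L}
    (h : s.idxOf x < s.idxOf y + k) : (newPart m ω s ^ k) x y = 0 := by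
  induction k generalizing x with
  | zero => exact Matrix.one_apply_ne (by rintro rfl; simp at h)
  | succ k ih =>
    rw [pow_succ', Matrix.mul_apply]
    refine sum_eq_zero fun w _ => ?_
    by_cases hw : s.idxOf w < s.idxOf x
    · rw [ih (by omega), mul_zero]
    · rw [newPart, if_neg hw, zero_mul]

lemma newPart_pow_eq_zero (s : List (Site d L)) {k : ℕ} (hk : s.length < k) :
    newPart m ω s ^ k = 0 := by
  ext x y
  have : s.idxOf x ≤ s.length := List.idxOf_le_length
  exact newPart_pow_apply_eq_zero s k (by omega)

lemma sweepUpdate_eq {s : List (Site d L)} (hs : s.Nodup) (hc : ∀ x, x ∈ s) :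
    sweepUpdate m ω s =
      1 + (∑ k ∈ range (s.length + 1), newPart m ω s ^ k) * increment d L m ω := by
  have h := sweepUpdate_sub_one (m := m) (ω := ω) hs hc
  have h₁ : (1 - newPart m ω s) * (sweepUpdate m ω s - 1) = increment d L m ω := by
    rw [sub_mul, one_mul]
    exact sub_eq_iff_eq_add.mpr h
  have h₂ : (∑ k ∈ range (s.length + 1), newPart m ω s ^ k) * (1 - newPart m ω s) = 1 := by
    rw [geom_sum_mul_neg, newPart_pow_eq_zero s (Nat.lt_succ_self _), sub_zero]
  rw [← h₁, ← mul_assoc, h₂, one_mul, add_sub_cancel]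

omit [NeZero L] in
lemma IsLexSweep.idxOf_lt_add {s : List (Site d L)} (hs : IsLexSweep s) {x : Site d L}
    {μ : Fin d} (h : x μ ≠ 0) : s.idxOf x < s.idxOf (x + unitVec μ) := by
  have := hs.before (x + unitVec μ) μ (by simpa [unitVec] using h)
  rwa [add_sub_cancel_right] at this

omit [NeZero L] in
lemma IsLexSweep.idxOf_lt_add_nsmul {s : List (Site d L)} (hs : IsLexSweep s) {x : Site d L}
    {μ : Fin d} (hx : x μ = 1) {j : ℕ} (hj₀ : 0 < j) (hj : j < L) :
    s.idxOf x < s.idxOf (x + j • unitVec μ) := by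
  induction j, hj₀ using Nat.le_induction with
  | base =>
    rw [show Nat.succ 0 = 1 from rfl, one_nsmul]
    apply hs.idxOf_lt_add
    rw [hx]
    have : Fact (1 < L) := ⟨by omega⟩
    exact one_ne_zero
  | succ j hj₀ ih =>
    rw [succ_nsmul, ← add_assoc]
    refine (ih (by omega)).trans (hs.idxOf_lt_add ?_)
    have : ((j + 1 : ℕ) : ZMod L) ≠ 0 := by
      rw [Ne, ZMod.natCast_eq_zero_iff]
      exact fun h => absurd (Nat.le_of_dvd (by omega) h) (by omega)
    simpa [unitVec, hx, add_comm] using this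

/-- By periodicity the neighbour below label 1 has label L, which is reached from `x` by L - 1
upward steps that never cross the boundary. -/
lemma IsLexSweep.idxOf_lt_sub {s : List (Site d L)} (hs : IsLexSweep s) {x : Site d L}
    {μ : Fin d} (hx : x μ = 1) (h : x μ ≠ 0) : s.idxOf x < s.idxOf (x - unitVec μ) := by
  have hL : 1 < L := by
    by_contra hL
    obtain rfl : L = 1 := le_antisymm (not_lt.mp hL) (NeZero.pos L)
    exact h (Subsingleton.elim _ _)
  have hsub : x - unitVec μ = x + (L - 1) • unitVec μ := by
    have h0 : L • (unitVec μ : Site d L) = 0 := by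
      ext ν
      simp
    rw [sub_eq_iff_eq_add, add_assoc, ← succ_nsmul, Nat.sub_add_cancel hL.le, h0, add_zero]
  rw [hsub]
  exact hs.idxOf_lt_add_nsmul hx (by omega) (by omega)

lemma IsLexSweep.idxOf_sub_lt_iff {s : List (Site d L)} (hs : IsLexSweep s) (x : Site d L)
    (μ : Fin d) : s.idxOf (x - unitVec μ) < s.idxOf x ↔ x μ ≠ 1 := by
  refine ⟨fun h hx => ?_, hs.before x μ⟩
  -- Labels 0 and 1 coincide only for L = 1, where a site is its own neighbour.
  by_cases h0 : x μ = 0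
  · have : (unitVec μ : Site d L) = 0 := by
      rw [unitVec, ← hx, h0, Pi.single_zero]
    simp [this] at h
  · exact absurd (hs.idxOf_lt_sub hx h0) h.asymm

lemma IsLexSweep.idxOf_add_lt_iff {s : List (Site d L)} (hs : IsLexSweep s) (x : Site d L)
    (μ : Fin d) : s.idxOf (x + unitVec μ) < s.idxOf x ↔ x μ = 0 ∧ x μ ≠ 1 := by
  constructor
  · intro h
    have h0 : x μ = 0 := by
      by_contra h0
      exact absurd (hs.idxOf_lt_add h0) h.asymm
    refine ⟨h0, fun h1 => ?_⟩
    have : (unitVec μ : Site d L) = 0 := by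
      rw [unitVec, ← h1, h0, Pi.single_zero]
    simp [this] at h
  · rintro ⟨h0, h1⟩
    have := hs.idxOf_lt_sub (x := x + unitVec μ) (μ := μ) (by simp [unitVec, h0])
      (by simpa [unitVec, h0, eq_comm] using h1)
    rwa [add_sub_cancel_right] at this

end Sweep

/-! ### Tensor products and momentum space -/

section Tensor

variable {d L : ℕ} [NeZero L]

/-- The tensor product of matrices on one-dimensional lattices, one for each direction. -/
def tensor (T : Fin d → Matrix (ZMod L) (ZMod L) ℝ) : Matrix (Site d L) (Site d L) ℝ :=
  fun x y => ∏ μ, T μ (x μ) (y μ)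

lemma tensor_mul (S T : Fin d → Matrix (ZMod L) (ZMod L) ℝ) :
    tensor S * tensor T = tensor fun μ => S μ * T μ := by
  ext x y
  simp only [tensor, Matrix.mul_apply, ← prod_mul_distrib]
  exact (Fintype.prod_sum fun μ z => S μ (x μ) z * T μ z (y μ)).symm

omit [NeZero L] in
lemma tensor_one : tensor (fun _ => 1 : Fin d → Matrix (ZMod L) (ZMod L) ℝ) = 1 := by
  ext x y
  simp only [tensor, Matrix.one_apply, prod_ite_zero, prod_const_one, mem_univ, true_imp_iff,
    funext_iff]

lemma phase_neg_dotProduct (p x : Site d L) :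
    phase (-(p ⬝ᵥ x)) = ∏ μ, phase (-(p μ * x μ)) := by
  rw [dotProduct, ← sum_neg_distrib, phase_sum]

lemma phase_dotProduct (p x : Site d L) : phase (p ⬝ᵥ x) = ∏ μ, phase (p μ * x μ) := by
  rw [dotProduct, phase_sum]

lemma momentumMatrix_tensor (T : Fin d → Matrix (ZMod L) (ZMod L) ℝ) (p q : Site d L) :
    momentumMatrix (tensor T) p q = ∏ μ, momentumMatrix₁ (T μ) (p μ) (q μ) := by
  simp only [momentumMatrix, momentumMatrix₁, prod_mul_distrib, prod_const, card_univ,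
    Fintype.card_fin, Fintype.prod_sum, phase_neg_dotProduct, phase_dotProduct, tensor,
    Complex.ofReal_prod, div_pow, one_pow]

lemma momentumMatrix_add (A B : Matrix (Site d L) (Site d L) ℝ) :
    momentumMatrix (A + B) = momentumMatrix A + momentumMatrix B := by
  ext p q
  simp only [momentumMatrix, Matrix.add_apply, Complex.ofReal_add, mul_add, add_mul,
    sum_add_distrib]

lemma momentumMatrix_smul (c : ℝ) (A : Matrix (Site d L) (Site d L) ℝ) :
    momentumMatrix (c • A) = (c : ℂ) • momentumMatrix A := by
  ext p q
  simp only [momentumMatrix, Matrix.smul_apply, smul_eq_mul, Complex.ofReal_mul, mul_sum]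
  refine sum_congr rfl fun x _ => sum_congr rfl fun y _ => ?_
  ring

lemma momentumMatrix_zero :
    momentumMatrix (0 : Matrix (Site d L) (Site d L) ℝ) = 0 := by
  ext p q
  simp [momentumMatrix]

lemma momentumMatrix_sum {ι : Type*} (s : Finset ι) (A : ι → Matrix (Site d L) (Site d L) ℝ) :
    momentumMatrix (∑ i ∈ s, A i) = ∑ i ∈ s, momentumMatrix (A i) := by
  classical
  induction s using Finset.induction_on with
  | empty => simp [momentumMatrix_zero]
  | insert a s ha ih => rw [sum_insert ha, sum_insert ha, momentumMatrix_add, ih]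

lemma momentumMatrix_one :
    momentumMatrix (1 : Matrix (Site d L) (Site d L) ℝ) = 1 := by
  ext p q
  rw [← tensor_one, momentumMatrix_tensor]
  simp only [momentumMatrix₁_one, Matrix.one_apply, prod_ite_zero, prod_const_one, mem_univ,
    true_imp_iff, funext_iff]

/-- The eigenvalue of the increment on the plane wave of momentum `q`. -/
noncomputable def symbol (m ω : ℝ) (q : Site d L) : ℂ :=
  -(ω : ℂ) + hop d m ω * ∑ μ, (phase (q μ) + phase (-(q μ)))

lemma sum_increment_mul_phase (m ω : ℝ) (x q : Site d L) :
    ∑ y, (increment d L m ω x y : ℂ) * phase (q ⬝ᵥ y) = symbol m ω q * phase (q ⬝ᵥ x) := by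
  have h₁ : ∀ z : Site d L, ∑ y, (((if z = y then 1 else 0 : ℝ)) : ℂ) * phase (q ⬝ᵥ y) =
      phase (q ⬝ᵥ z) := by
    intro z
    simp only [apply_ite Complex.ofReal, Complex.ofReal_one, Complex.ofReal_zero, ite_mul, one_mul,
      zero_mul, sum_ite_eq, mem_univ, if_true]
  have h₂ : ∀ μ : Fin d, q ⬝ᵥ unitVec μ = q μ := by
    intro μ
    simp [unitVec]
  simp only [increment, Complex.ofReal_add, Complex.ofReal_mul, Complex.ofReal_sum, add_mul,
    sum_add_distrib, mul_assoc, ← mul_sum, sum_mul]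
  rw [h₁, sum_comm]
  simp only [sum_add_distrib, h₁, dotProduct_add, sub_eq_add_neg, h₂, phase_add,
    symbol, Complex.ofReal_neg, add_mul, mul_assoc, mul_add, mul_sum, sum_mul]
  rw [sum_comm (s := univ (α := Site d L))]
  simp only [← mul_sum, h₁, dotProduct_add, dotProduct_neg, h₂, phase_add]
  simp only [mul_comm (phase (q ⬝ᵥ x)), sum_mul]

/-- Plane waves are eigenvectors of the translation invariant increment. -/
lemma momentumMatrix_mul_increment (m ω : ℝ) (A : Matrix (Site d L) (Site d L) ℝ)
    (p q : Site d L) :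
    momentumMatrix (A * increment d L m ω) p q = momentumMatrix A p q * symbol m ω q := by
  rw [momentumMatrix, momentumMatrix, mul_assoc, sum_mul]
  congr 1
  refine sum_congr rfl fun x _ => ?_
  simp only [Matrix.mul_apply, Complex.ofReal_sum, Complex.ofReal_mul, mul_sum, sum_mul]
  rw [sum_comm]
  refine sum_congr rfl fun z _ => ?_
  rw [mul_assoc, mul_comm (phase (q ⬝ᵥ z)), ← sum_increment_mul_phase, mul_sum]
  exact sum_congr rfl fun y _ => by ring

lemma norm_symbol_le (m ω : ℝ) (q : Site d L) : ‖symbol m ω q‖ ≤ |ω| + |hop d m ω| * (2 * d) := by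
  have h : ‖∑ μ : Fin d, (phase (q μ) + phase (-(q μ)))‖ ≤ 2 * d := by
    refine (norm_sum_le_of_le (f := fun μ => phase (q μ) + phase (-(q μ))) univ
      (fun μ _ => (norm_add_le _ _).trans_eq (by rw [norm_phase, norm_phase]))).trans_eq ?_
    simp
    ring
  refine (norm_add_le _ _).trans ?_
  rw [norm_neg, norm_mul, Complex.norm_real, Complex.norm_real, Real.norm_eq_abs, Real.norm_eq_abs]
  gcongr

/-- The dependence of a site on its neighbours that are updated earlier in a lexicographic
sweep. -/
def earlierSum (d L : ℕ) [NeZero L] : Matrix (Site d L) (Site d L) ℝ :=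
  ∑ μ : Fin d, tensor fun ν => earlier L ^ (Pi.single μ 1 : Fin d → ℕ) ν

lemma tensor_earlier_single (μ : Fin d) (x y : Site d L) :
    tensor (fun ν => earlier L ^ (Pi.single μ 1 : Fin d → ℕ) ν) x y =
      (if x μ ≠ 1 ∧ x - unitVec μ = y then 1 else 0) +
        (if (x μ = 0 ∧ x μ ≠ 1) ∧ x + unitVec μ = y then 1 else 0) := by
  have hprod : tensor (fun ν => earlier L ^ (Pi.single μ 1 : Fin d → ℕ) ν) x y =
      earlier L (x μ) (y μ) * if ∀ ν, ν ≠ μ → x ν = y ν then 1 else 0 := by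
    rw [tensor, ← mul_prod_erase univ _ (mem_univ μ), Pi.single_eq_same, pow_one]
    congr 1
    rw [prod_congr rfl (g := fun ν => if x ν = y ν then (1 : ℝ) else 0), prod_ite_zero,
      prod_const_one]
    · simp
    · intro ν hν
      rw [Pi.single_eq_of_ne (ne_of_mem_erase hν), pow_zero, Matrix.one_apply]
  have hadd : ∀ c : ZMod L, x + Pi.single μ c = y ↔ x μ + c = y μ ∧ ∀ ν, ν ≠ μ → x ν = y ν := by
    intro c
    rw [funext_iff]
    refine ⟨fun h => ⟨by simpa using h μ, fun ν hν => by simpa [hν] using h ν⟩, fun h ν => ?_⟩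
    by_cases hν : ν = μ
    · subst hν
      simpa using h.1
    · simpa [hν] using h.2 ν hν
  have hsub : x - unitVec μ = y ↔ x μ - 1 = y μ ∧ ∀ ν, ν ≠ μ → x ν = y ν := by
    rw [sub_eq_add_neg, unitVec, ← Pi.single_neg, hadd, sub_eq_add_neg]
  have hearlier : earlier L (x μ) (y μ) = (if x μ ≠ 1 ∧ x μ - 1 = y μ then 1 else 0) +
      (if (x μ = 0 ∧ x μ ≠ 1) ∧ x μ + 1 = y μ then 1 else 0) := rfl
  rw [hprod, hearlier, add_mul]
  congr 1
  · simp only [hsub, ite_zero_mul_ite_zero, mul_one, and_assoc]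
  · simp only [unitVec, hadd, ite_zero_mul_ite_zero, mul_one, and_assoc]

/-- The order of any two neighbours is forced by the lexicographic condition, so N is the same for
all such sweeps. The two neighbours in a direction are kept as separate terms, which gives the right
multiplicity when they coincide at L = 2. -/
lemma newPart_eq {m ω : ℝ} {s : List (Site d L)} (hs : IsLexSweep s) :
    newPart m ω s = hop d m ω • earlierSum d L := by
  ext x y
  rw [Matrix.smul_apply, earlierSum, Matrix.sum_apply, smul_eq_mul, newPart, increment]
  have h₁ : ∀ (P : Prop) [Decidable P] (z : Site d L), (P ↔ s.idxOf z < s.idxOf x) →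
      (if P ∧ z = y then (1 : ℝ) else 0) =
        if s.idxOf y < s.idxOf x then (if z = y then 1 else 0) else 0 := by
    intro P _ z hP
    rw [← ite_and]
    refine if_congr (and_congr_left ?_) rfl rfl
    rintro rfl
    exact hP
  simp only [tensor_earlier_single, h₁ _ _ (hs.idxOf_sub_lt_iff x _).symm,
    h₁ _ _ (hs.idxOf_add_lt_iff x _).symm]
  by_cases h : s.idxOf y < s.idxOf x
  · have hxy : x ≠ y := by
      rintro rfl
      exact h.false
    simp only [if_pos h, if_neg hxy, mul_zero, zero_add]
    simp only [add_comm]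
  · simp [h]

end Tensor

/-! ### Expansion in modified Kronecker deltas -/

section Expansion

variable {d L : ℕ} [NeZero L]

/-- The coefficients `f` expand `A` in momentum space in modified Kronecker deltas, with diagonal
part `g` and with bound `B`. -/
structure IsExpansion (f : Finset (Fin d) → Matrix (Site d L) (Site d L) ℂ)
    (A : Matrix (Site d L) (Site d L) ℝ) (g : Site d L → ℂ) (B : ℝ) : Prop where
  eq : ∀ p q, momentumMatrix A p q = ∑ α, 1 / (L : ℂ) ^ #α * (partialDelta α p q * f α p q)
  diag : ∀ p q, f ∅ p q = g p
  bound : ∀ α p q, ‖f α p q‖ ≤ B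

lemma IsExpansion.sum {ι : Type*} (s : Finset ι)
    {f : ι → Finset (Fin d) → Matrix (Site d L) (Site d L) ℂ}
    {A : ι → Matrix (Site d L) (Site d L) ℝ} {g : ι → Site d L → ℂ} {B : ℝ}
    (h : ∀ i ∈ s, IsExpansion (f i) (A i) (g i) B) :
    IsExpansion (fun α p q => ∑ i ∈ s, f i α p q) (∑ i ∈ s, A i) (fun p => ∑ i ∈ s, g i p)
      (#s * B) where
  eq p q := by
    rw [momentumMatrix_sum, Matrix.sum_apply, sum_congr rfl fun i hi => (h i hi).eq p q, sum_comm]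
    simp only [mul_sum]
  diag p q := sum_congr rfl fun i hi => (h i hi).diag p q
  bound α p q := by
    refine (norm_sum_le_of_le s fun i hi => (h i hi).bound α p q).trans_eq ?_
    rw [sum_const, nsmul_eq_mul]

lemma norm_momentumMatrix₁_remainder_le (n : ℕ) (p q : ZMod L) :
    ‖(L : ℂ) * momentumMatrix₁ (earlier L ^ n - shiftBack L ^ n) p q‖ ≤ 2 * n := by
  have hL : (L : ℝ) ≠ 0 := Nat.cast_ne_zero.mpr (NeZero.ne L)
  rw [norm_mul, Complex.norm_natCast]
  calc (L : ℝ) * ‖momentumMatrix₁ (earlier L ^ n - shiftBack L ^ n) p q‖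
      ≤ L * (1 / L * (2 * n)) := by
        gcongr
        exact (norm_momentumMatrix₁_le _ p q).trans (by gcongr; exact entrySum_earlier_pow_sub n)
    _ = 2 * n := by field_simp

lemma exists_isExpansion_tensor (n : Fin d → ℕ) :
    ∃ f, IsExpansion f (tensor fun μ => earlier L ^ n μ) (fun p => ∏ μ, phase (-(p μ)) ^ n μ)
      ((2 * ∑ μ, (n μ : ℝ) + 1) ^ d) := by
  have hL : (L : ℂ) ≠ 0 := Nat.cast_ne_zero.mpr (NeZero.ne L)
  let r : Fin d → Site d L → Site d L → ℂ := fun μ p q =>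
    L * momentumMatrix₁ (earlier L ^ n μ - shiftBack L ^ n μ) (p μ) (q μ)
  -- Directions in α carry the rescaled boundary correction `r`, the others the phase of the
  -- periodic shift.
  refine ⟨fun α p q => (∏ μ ∈ α, r μ p q) * ∏ μ ∈ αᶜ, phase (-(p μ)) ^ n μ, ?_, ?_, ?_⟩
  · intro p q
    have h : ∀ μ, momentumMatrix₁ (earlier L ^ n μ) (p μ) (q μ) =
        1 / L * r μ p q + (if p μ = q μ then 1 else 0) * phase (-(p μ)) ^ n μ := by
      intro μ
      rw [← momentumMatrix₁_shiftBack_pow, one_div, inv_mul_cancel_left₀ hL,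
        ← momentumMatrix₁_add, sub_add_cancel]
    rw [momentumMatrix_tensor, prod_congr rfl fun μ _ => h μ, prod_add, powerset_univ]
    refine sum_congr rfl fun α _ => ?_
    rw [← compl_eq_univ_sdiff, prod_mul_distrib, prod_mul_distrib (s := αᶜ),
      prod_const, div_pow, one_pow,
      partialDelta]
    ring
  · intro p q
    simp
  · intro α p q
    have h₁ : (1 : ℝ) ≤ 2 * ∑ μ, (n μ : ℝ) + 1 := by
      have : 0 ≤ ∑ μ, (n μ : ℝ) := sum_nonneg fun μ _ => (n μ).cast_nonneg
      linarith
    have h₂ : ‖∏ μ ∈ αᶜ, phase (-(p μ)) ^ n μ‖ = 1 := by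
      rw [norm_prod]
      exact prod_eq_one fun μ _ => by rw [norm_pow, norm_phase, one_pow]
    rw [norm_mul, h₂, mul_one, norm_prod]
    calc ∏ μ ∈ α, ‖r μ p q‖ ≤ ∏ μ ∈ α, (2 * ∑ μ, (n μ : ℝ) + 1) := by
          refine prod_le_prod (fun μ _ => norm_nonneg _) fun μ _ => ?_
          refine (norm_momentumMatrix₁_remainder_le _ _ _).trans ?_
          have := single_le_sum (f := fun μ => (n μ : ℝ)) (fun μ _ => (n μ).cast_nonneg)
            (mem_univ μ)
          linarith
      _ = (2 * ∑ μ, (n μ : ℝ) + 1) ^ #α := prod_const _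
      _ ≤ _ := pow_le_pow_right₀ h₁ (by simpa using card_le_univ α)

/-- The general exponent vector `n` closes the induction: one factor `earlierSum` raises one
exponent by one, in d possible directions. -/
lemma exists_isExpansion_earlierSum_pow_mul_tensor (k : ℕ) (n : Fin d → ℕ) :
    ∃ f, IsExpansion f (earlierSum d L ^ k * tensor fun μ => earlier L ^ n μ)
      (fun p => (∑ μ, phase (-(p μ))) ^ k * ∏ μ, phase (-(p μ)) ^ n μ)
      ((d : ℝ) ^ k * (2 * (∑ μ, (n μ : ℝ) + k) + 1) ^ d) := by
  induction k generalizing n with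
  | zero => simpa using exists_isExpansion_tensor n
  | succ k ih =>
    choose f hf using fun μ : Fin d => ih (Pi.single μ 1 + n)
    have hcard : ∀ μ : Fin d, ∑ ν, (((Pi.single μ 1 + n : Fin d → ℕ) ν : ℕ) : ℝ) =
        1 + ∑ ν, (n ν : ℝ) := by
      intro μ
      simp [sum_add_distrib, Pi.single_apply]
    have hphase : ∀ (μ : Fin d) (p : Site d L),
        ∏ ν, phase (-(p ν)) ^ (Pi.single μ 1 + n : Fin d → ℕ) ν =
          phase (-(p μ)) * ∏ ν, phase (-(p ν)) ^ n ν := by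
      intro μ p
      simp only [Pi.add_apply, pow_add, prod_mul_distrib, Pi.single_apply, pow_ite, pow_one, pow_zero,
        prod_ite_eq', mem_univ, if_true]
    simp only [hcard, hphase] at hf
    refine ⟨fun α p q => ∑ μ, f μ α p q, ?_⟩
    convert IsExpansion.sum univ fun μ _ => hf μ using 1
    · rw [pow_succ, mul_assoc, ← mul_sum]
      congr 1
      rw [earlierSum, sum_mul]
      refine sum_congr rfl fun μ _ => ?_
      rw [tensor_mul]
      simp only [← pow_add, Pi.add_apply]
    · ext p
      rw [← mul_sum, ← sum_mul]
      ring
    · rw [card_univ, Fintype.card_fin]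
      push_cast
      ring

lemma exists_isExpansion_earlierSum_pow (k : ℕ) :
    ∃ f, IsExpansion f (earlierSum d L ^ k) (fun p => (∑ μ, phase (-(p μ))) ^ k)
      ((d : ℝ) ^ k * (2 * (k + 1)) ^ d) := by
  obtain ⟨f, hf⟩ := exists_isExpansion_earlierSum_pow_mul_tensor (d := d) (L := L) k 0
  simp only [Pi.zero_apply, pow_zero, tensor_one, mul_one, prod_const_one, Nat.cast_zero,
    sum_const_zero, zero_add] at hf
  refine ⟨f, hf.eq, hf.diag, fun α p q => (hf.bound α p q).trans ?_⟩
  gcongr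
  linarith

/-- Comparison with a binomial series, through (k+1)^d ≤ d! (k+d choose d). -/
lemma summable_pow_mul_add_one_pow {r : ℝ} (hr₀ : 0 ≤ r) (hr : r < 1) (d : ℕ) :
    Summable fun k : ℕ => r ^ k * (2 * ((k : ℝ) + 1)) ^ d := by
  have h := (summable_choose_mul_geometric_of_norm_lt_one (R := ℝ) d
    (by rwa [Real.norm_of_nonneg hr₀] : ‖r‖ < 1)).mul_left (2 ^ d * (d.factorial : ℝ))
  refine Summable.of_nonneg_of_le (fun k => by positivity) (fun k => ?_) h
  have hk : ((k : ℝ) + 1) ^ d ≤ d.factorial * (k + d).choose d := by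
    have := Nat.pow_succ_le_ascFactorial (k + 1) d
    rw [Nat.ascFactorial_eq_factorial_mul_choose] at this
    exact_mod_cast this
  rw [mul_pow]
  calc r ^ k * (2 ^ d * ((k : ℝ) + 1) ^ d)
      ≤ r ^ k * (2 ^ d * (d.factorial * (k + d).choose d)) := by gcongr
    _ = _ := by ring

/-- The bound on the expansion of the resolvent of the earlier part. -/
noncomputable def resolventBound (d : ℕ) (t : ℝ) : ℝ :=
  ∑' k : ℕ, (t * d) ^ k * (2 * ((k : ℝ) + 1)) ^ d

lemma norm_mul_sum_phase_lt {t : ℝ} (ht₀ : 0 ≤ t) (ht : t * d < 1) (p : Site d L) :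
    ‖(t : ℂ) * ∑ μ, phase (-(p μ))‖ < 1 := by
  refine lt_of_le_of_lt ?_ ht
  rw [norm_mul, Complex.norm_real, Real.norm_of_nonneg ht₀]
  gcongr
  refine (norm_sum_le_of_le (f := fun μ => phase (-(p μ))) univ
    fun μ _ => (norm_phase _).le).trans_eq ?_
  simp

lemma one_sub_mul_sum_phase_ne_zero {t : ℝ} (ht₀ : 0 ≤ t) (ht : t * d < 1) (p : Site d L) :
    1 - (t : ℂ) * ∑ μ, phase (-(p μ)) ≠ 0 := by
  intro h
  have := norm_mul_sum_phase_lt ht₀ ht p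
  rw [← sub_eq_zero.mp h, norm_one] at this
  exact this.false

/-- The powers vanish from `K` on, but their individual coefficients need not: they only cancel in
the sum over α. Including them changes nothing in the matrix and completes the geometric series on
the diagonal. -/
lemma exists_isExpansion_resolvent {t : ℝ} (ht₀ : 0 ≤ t) (ht : t * d < 1) {K : ℕ}
    (hK : ∀ k, K ≤ k → (t • earlierSum d L) ^ k = 0) :
    ∃ f, IsExpansion f (∑ k ∈ range K, (t • earlierSum d L) ^ k)
      (fun p => (1 - t * ∑ μ, phase (-(p μ)))⁻¹) (resolventBound d t) := by
  choose f hf using exists_isExpansion_earlierSum_pow (d := d) (L := L)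
  have hle : ∀ α p q k, ‖(t : ℂ) ^ k * f k α p q‖ ≤ (t * d) ^ k * (2 * ((k : ℝ) + 1)) ^ d := by
    intro α p q k
    rw [norm_mul, norm_pow, Complex.norm_real, Real.norm_of_nonneg ht₀, mul_pow, mul_assoc]
    gcongr
    exact (hf k).bound α p q
  have hsum := summable_pow_mul_add_one_pow (r := t * d) (by positivity) ht d
  have hs : ∀ α p q, Summable fun k => (t : ℂ) ^ k * f k α p q := fun α p q =>
    Summable.of_norm_bounded hsum (hle α p q)
  refine ⟨fun α p q => ∑' k, (t : ℂ) ^ k * f k α p q, ?_, ?_, ?_⟩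
  · intro p q
    have hmom : ∀ k, momentumMatrix ((t • earlierSum d L) ^ k) p q =
        ∑ α, 1 / (L : ℂ) ^ #α * (partialDelta α p q * ((t : ℂ) ^ k * f k α p q)) := by
      intro k
      rw [smul_pow, momentumMatrix_smul, Matrix.smul_apply, (hf k).eq, smul_eq_mul, mul_sum]
      refine sum_congr rfl fun α _ => ?_
      push_cast
      ring
    have h₁ : HasSum (fun k => momentumMatrix ((t • earlierSum d L) ^ k) p q)
        (∑ α, 1 / (L : ℂ) ^ #α * (partialDelta α p q * ∑' k, (t : ℂ) ^ k * f k α p q)) := by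
      simp only [hmom]
      exact hasSum_sum fun α _ => ((hs α p q).hasSum.mul_left _).mul_left _
    have h₂ : HasSum (fun k => momentumMatrix ((t • earlierSum d L) ^ k) p q)
        (∑ k ∈ range K, momentumMatrix ((t • earlierSum d L) ^ k) p q) := by
      refine hasSum_sum_of_ne_finset_zero fun k hk => ?_
      rw [hK k (by simpa using hk), momentumMatrix_zero, Matrix.zero_apply]
    rw [momentumMatrix_sum, Matrix.sum_apply, h₂.unique h₁]
  · intro p q
    simp only [(hf _).diag, ← mul_pow]
    exact tsum_geometric_of_norm_lt_one (norm_mul_sum_phase_lt ht₀ ht p)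
  · intro α p q
    exact tsum_of_norm_bounded hsum.hasSum (hle α p q)

omit [NeZero L] in
lemma partialDelta_empty (p q : Site d L) : partialDelta ∅ p q = if p = q then 1 else 0 := by
  simp only [partialDelta, compl_empty, prod_ite_zero, prod_const_one, mem_univ, true_imp_iff,
    funext_iff]

/-- This combines 1 + (1 - N^D)⁻¹ `symbol` into (1 - N^D)⁻¹ O^D. -/
lemma symbol_add_eq (m ω : ℝ) (p : Site d L) :
    1 - (hop d m ω : ℂ) * ∑ μ, phase (-(p μ)) + symbol m ω p =
      1 - (ω : ℂ) + hop d m ω * ∑ μ, phase (p μ) := by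
  rw [symbol, sum_add_distrib]
  ring

lemma exists_isExpansion_sweepUpdate {m ω : ℝ} (ht₀ : 0 ≤ hop d m ω) (ht : hop d m ω * d < 1)
    {s : List (Site d L)} (hs : IsLexSweep s) :
    ∃ f : Finset (Fin d) → Matrix (Site d L) (Site d L) ℂ,
      (∀ p q, momentumMatrix (sweepUpdate m ω s) p q =
        ∑ α, 1 / (L : ℂ) ^ #α * (partialDelta α p q * f α p q)) ∧
      (∀ p, f ∅ p p = (1 - (ω : ℂ) + hop d m ω * ∑ μ, phase (p μ)) /
        (1 - hop d m ω * ∑ μ, phase (-(p μ)))) ∧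
      ∀ α p q, ‖f α p q‖ ≤ 1 + resolventBound d (hop d m ω) * (|ω| + |hop d m ω| * (2 * d)) := by
  obtain ⟨f, hf⟩ := exists_isExpansion_resolvent (L := L) (K := s.length + 1) ht₀ ht fun k hk => by
    rw [← newPart_eq hs, newPart_pow_eq_zero s hk]
  -- The identity summand is diagonal, so it belongs to α = ∅ alone.
  refine ⟨fun α p q => (if α = ∅ then 1 else 0) + f α p q * symbol m ω q, ?_, ?_, ?_⟩
  · intro p q
    rw [sweepUpdate_eq hs.nodup hs.complete, newPart_eq hs, momentumMatrix_add, momentumMatrix_one,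
      Matrix.add_apply, momentumMatrix_mul_increment, hf.eq, sum_mul]
    simp only [mul_add, sum_add_distrib]
    congr 1
    · simp [partialDelta_empty, Matrix.one_apply]
    · exact sum_congr rfl fun α _ => by ring
  · intro p
    have hne := one_sub_mul_sum_phase_ne_zero ht₀ ht p
    change (if (∅ : Finset (Fin d)) = ∅ then (1 : ℂ) else 0) + f ∅ p p * symbol m ω p = _
    rw [if_pos rfl, hf.diag, ← symbol_add_eq, add_div, div_self hne, inv_mul_eq_div]
  · intro α p q
    refine (norm_add_le _ _).trans (add_le_add ?_ ?_)
    · split_ifs <;> simp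
    · rw [norm_mul]
      exact mul_le_mul (hf.bound α p q) (norm_symbol_le m ω q) (norm_nonneg _)
        ((norm_nonneg _).trans (hf.bound α p q))

lemma leadingDiag_eq {m ω : ℝ} (ht₀ : 0 ≤ hop d m ω) (ht : hop d m ω * d < 1) :
    leadingDiag d L m ω = (1 - newDiag d L m ω)⁻¹ * oldDiag d L m ω := by
  have hinv : (1 - newDiag d L m ω)⁻¹ =
      Matrix.diagonal fun p => (1 - (hop d m ω : ℂ) * ∑ μ, phase (-(p μ)))⁻¹ := by
    apply Matrix.inv_eq_right_inv
    rw [newDiag, ← Matrix.diagonal_one, Matrix.diagonal_sub, Matrix.diagonal_mul_diagonal]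
    congr 1
    ext p
    exact mul_inv_cancel₀ (one_sub_mul_sum_phase_ne_zero ht₀ ht p)
  rw [hinv, oldDiag, leadingDiag, Matrix.diagonal_mul_diagonal]
  congr 1
  ext p
  rw [inv_mul_eq_div]

end Expansion

lemma hop_nonneg {d : ℕ} {m ω : ℝ} (hω : 0 ≤ ω) : 0 ≤ hop d m ω := by
  rw [hop, siteFreqSq]
  positivity

lemma hop_lt {d : ℕ} {m ω : ℝ} (hd : 1 ≤ d) (hm : 0 < m) (hω : ω ≤ 2) :
    hop d m ω < 1 / (d : ℝ) := by
  have hd' : (0 : ℝ) < d := by exact_mod_cast hd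
  rw [hop, siteFreqSq, div_lt_div_iff₀ (by positivity) hd']
  nlinarith [pow_pos hm 2]

end LexUpdate

open Finset LexUpdate in
/-- The remainder `E` can be taken to be zero: the powers of the one-dimensional matrix `earlier L`
differ from those of the periodic shift by at most `2 n` in `entrySum`, for every exponent `n`
including `n ≥ L`, and so the expansion in modified Kronecker deltas is exact. -/
theorem mainTheorem4 (d : ℕ) (hd : 1 ≤ d) (m ω : ℝ) (hm : 0 < m) (hω₀ : 0 ≤ ω) (hω₂ : ω ≤ 2) :
    LexUpdate.hop d m ω < 1 / (d : ℝ) ∧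
    ∃ C : ℝ, ∀ (L : ℕ) [NeZero L] (s : List (LexUpdate.Site d L)), LexUpdate.IsLexSweep s →
      ∃ (G : ℕ → Matrix (LexUpdate.Site d L) (LexUpdate.Site d L) ℂ)
        (Ghat : Finset (Fin d) → Matrix (LexUpdate.Site d L) (LexUpdate.Site d L) ℂ)
        (E : Matrix (LexUpdate.Site d L) (LexUpdate.Site d L) ℂ),
        LexUpdate.momentumMatrix (LexUpdate.sweepUpdate m ω s) =
            (∑ l ∈ Finset.range (d + 1), (1 / (L : ℂ) ^ l) • G l) + E ∧
        (∀ l ≤ d, ∀ p q, G l p q =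
            ∑ α ∈ Finset.powersetCard l Finset.univ,
              LexUpdate.partialDelta α p q * Ghat α p q) ∧
        (∀ α p q, ‖Ghat α p q‖ ≤ C) ∧
        (∀ l ≤ d, ∀ p q, ‖G l p q‖ ≤ C) ∧
        G 0 = LexUpdate.leadingDiag d L m ω ∧
        LexUpdate.leadingDiag d L m ω =
            (1 - LexUpdate.newDiag d L m ω)⁻¹ * LexUpdate.oldDiag d L m ω ∧
        (∀ p q, ‖E p q‖ ≤ C * (1 / (L : ℝ) * LexUpdate.hop d m ω ^ L)) := by
  have hlt := hop_lt hd hm hω₂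
  have ht₀ : 0 ≤ hop d m ω := hop_nonneg hω₀
  have ht : hop d m ω * d < 1 := (lt_div_iff₀ (by exact_mod_cast hd)).mp hlt
  set B : ℝ := 1 + resolventBound d (hop d m ω) * (|ω| + |hop d m ω| * (2 * d))
  have hB₀ : 0 ≤ B := by
    have : 0 ≤ resolventBound d (hop d m ω) := tsum_nonneg fun k => by positivity
    positivity
  -- `B` bounds a single coefficient; 2^d bounds the number of subsets α summed in one `G l`.
  refine ⟨hlt, 2 ^ d * B, fun L _ s hs => ?_⟩
  obtain ⟨f, hf, hdiag, hbound⟩ := exists_isExpansion_sweepUpdate (L := L) ht₀ ht hs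
  refine ⟨fun l p q => ∑ α ∈ powersetCard l univ, partialDelta α p q * f α p q, f, 0, ?_,
    fun l _ p q => rfl, fun α p q => ?_, fun l _ p q => ?_, ?_, leadingDiag_eq ht₀ ht, ?_⟩
  · ext p q
    rw [hf, add_zero, Matrix.sum_apply, ← powerset_univ, sum_powerset, card_univ, Fintype.card_fin]
    refine sum_congr rfl fun l _ => ?_
    change _ = 1 / (L : ℂ) ^ l * ∑ α ∈ powersetCard l univ, partialDelta α p q * f α p q
    rw [mul_sum]
    exact sum_congr rfl fun α hα => by rw [(mem_powersetCard.mp hα).2]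
  · exact (hbound α p q).trans (le_mul_of_one_le_left hB₀ (one_le_pow₀ one_le_two))
  · have hδ : ∀ α : Finset (Fin d), ‖partialDelta α p q‖ ≤ 1 := by
      intro α
      rw [partialDelta, norm_prod]
      exact prod_le_one (fun _ _ => norm_nonneg _) fun ν _ => by split_ifs <;> simp
    calc ‖∑ α ∈ powersetCard l univ, partialDelta α p q * f α p q‖
        ≤ ∑ α ∈ powersetCard l univ, B := norm_sum_le_of_le _ fun α _ => by
          rw [norm_mul]
          exact (mul_le_of_le_one_left (norm_nonneg _) (hδ α)).trans (hbound α p q)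
      _ ≤ ∑ α : Finset (Fin d), B :=
          sum_le_sum_of_subset_of_nonneg (subset_univ _) fun _ _ _ => hB₀
      _ = 2 ^ d * B := by simp
  · ext p q
    simp only [powersetCard_zero, sum_singleton, partialDelta_empty, leadingDiag,
      Matrix.diagonal_apply]
    split_ifs with h
    · rw [← h, one_mul, hdiag]
    · rw [zero_mul]
  · intro p q
    rw [Matrix.zero_apply, norm_zero]
    positivity
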